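/- Let $G=(V\cup K,E)$ be a finite bipartite graph with sides $V$ and $K$ (every edge joins a vertex of $V$ to a vertex of $K$), and let $l,u\in\mathbb N^K$ with $l_j\le u_j$ for all $j\in K$ (where $0\in\mathbb N$). A *$G$-map* is a function $f:A\to K$ with $A\subseteq V$ and $\{v,f(v)\}\in E$ for all $v\in A$; it is *valid* if $l_j\le |f^{-1}(j)|\le u_j$ for all $j\in K$. For $0\le k\le |V|$ let $s_k$ be the number of valid $G$-maps $f:A\to K$ with $|A|=k$. Then the sequence $(s_0,\dots,s_{|V|})$ is ultra-log-concave. That is, with $n=|V|$: 1. it has no internal zeros: if $0\le i<j<k\le n$, $s_i\neq 0$ and $s_k\ne 0$, then $s_j\neq 0$; and 2. the sequence $\bigl(s_i/\binom{n}{i}\bigr)_{i=0}^{n}$ is log-concave: $\dfrac{s_i}{\binom ni}\cdot\dfrac{s_{i+2}}{\binom n{i+2}}\le\left(\dfrac{s_{i+1}}{\binom n{i+1}}\right)^2$ whenever $0\le i\le n-2$. -/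

import Mathlib

/-- A `G`-map of a bipartite graph `G` with sides `V` and `K`: a function `f : A → K`, defined on a
subset `A` (here `dom`) of `V`, with `v` adjacent to `f v` for every `v ∈ A`. -/
structure GMap {V K : Type*} (G : SimpleGraph (V ⊕ K)) where
  dom : Finset V
  toFun : dom → K
  adj : ∀ v : dom, G.Adj (Sum.inl (v : V)) (Sum.inr (toFun v))

/-- There are finitely many `G`-maps, so that counting them with `Nat.card` is meaningful. -/
instance GMap.instFinite {V K : Type*} [Finite V] [Finite K] (G : SimpleGraph (V ⊕ K)) :
    Finite (GMap G) := by
  apply Finite.of_injective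
    (fun f : GMap G => (⟨f.dom, f.toFun⟩ : (A : Finset V) × (A → K)))
  rintro ⟨A, f, hf⟩ ⟨B, g, hg⟩ h
  simp only [Sigma.mk.injEq] at h
  obtain ⟨rfl, h⟩ := h
  obtain rfl := eq_of_heq h
  rfl

/-- A `G`-map `f` is valid for the bounds `l, u` if `l j ≤ |f⁻¹(j)| ≤ u j` for all `j`. -/
def GMap.IsValid {V K : Type*} {G : SimpleGraph (V ⊕ K)} (f : GMap G) (l u : K → ℕ) : Prop :=
  ∀ j : K, l j ≤ (f.toFun ⁻¹' {j}).ncard ∧ (f.toFun ⁻¹' {j}).ncard ≤ u j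

/-- `numValid G l u k` is the number of valid `G`-maps whose domain has `k` elements. -/
noncomputable def numValid {V K : Type*} (G : SimpleGraph (V ⊕ K)) (l u : K → ℕ) (k : ℕ) : ℕ :=
  Nat.card {f : GMap G // f.IsValid l u ∧ f.dom.card = k}

/-- The finite sequence `(r 0, …, r n)` has no internal zeros. -/
def NoInternalZeros (n : ℕ) (r : ℕ → ℝ) : Prop :=
  ∀ i j k : ℕ, i < j → j < k → k ≤ n → r i ≠ 0 → r k ≠ 0 → r j ≠ 0

/-- The finite sequence `(r 0, …, r n)` is log-concave. -/
def IsLogConcave (n : ℕ) (r : ℕ → ℝ) : Prop :=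
  ∀ i : ℕ, i + 2 ≤ n → r i * r (i + 2) ≤ r (i + 1) ^ 2

/-- The finite sequence `(r 0, …, r n)` is ultra-log-concave: it has no internal zeros and
`(r i / (n choose i))`, for `i = 0, …, n`, is log-concave. -/
def IsUltraLogConcave (n : ℕ) (r : ℕ → ℝ) : Prop :=
  NoInternalZeros n r ∧ IsLogConcave n (fun i => r i / (n.choose i : ℝ))

/-!
A `G`-map is a total map `V → Option K`, with `none` for the vertices outside its domain, so valid
`G`-maps are the terms of the product of linear forms `∏ v, (y + ∑ j ~ v, x j)` whose exponents lie
within the bounds. The truncated form `P` is Lorentzian in the sense of Brändén and Huh, and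
specializing all `x j` to one variable gives a bivariate Lorentzian form with coefficients `s k`,
which is the same as ultra-log-concavity.

Forms are encoded by their iterated partial derivatives, as functions on multisets of indices
(`dirDeriv`, `contract`, `hessian`), and Lorentzian quadratic forms by the reverse Cauchy-Schwarz
inequality (`ReverseCauchySchwarz`). The engine is the local-to-global principle
`reverseCauchySchwarz_hessian_contract`: if the quadratic partial derivatives of a form with
nonnegative coefficients are Lorentzian and its support is M-convex, then the quadratic directional
derivatives along nonnegative vectors are Lorentzian too. Its inductive step
`ReverseCauchySchwarz.sum_smul` combines a Bochner-type inequality with Perron-Frobenius.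

The principle is used twice. Applied to `∏ v, z v`, whose quadratic partial derivatives are trivially
Lorentzian, it gives the Alexandrov-Fenchel inequality for permanents
(`reverseCauchySchwarz_hessian_permanentCoeff`), which says that the quadratic partial derivatives of
the product of linear forms are Lorentzian. Truncation changes such a quadratic form only by deleting
variables, by decreasing diagonal entries, or by leaving a single row and column, and so keeps it
Lorentzian (`reverseCauchySchwarz_hessian_truncate`). M-convexity of the support of `P` is an
augmenting path argument (`exists_exchange_map`), which also excludes internal zeros. The second
application, to `P`, gives log-concavity of the derivatives `mixedCount`, and these are
`n! s_k / (n choose k)` by `choose_mul_mixedCount`.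
-/

open Matrix

/-! ### Matrices with at most one positive eigenvalue -/

/-- The quadratic form of a symmetric matrix `M` satisfies the reverse Cauchy-Schwarz inequality at
every vector where it is positive. For symmetric `M` this says that `M` has at most one positive
eigenvalue. -/
def ReverseCauchySchwarz {ι : Type*} [Fintype ι] (M : Matrix ι ι ℝ) : Prop :=
  ∀ p q : ι → ℝ, 0 < p ⬝ᵥ M *ᵥ p →
    (p ⬝ᵥ M *ᵥ p) * (q ⬝ᵥ M *ᵥ q) ≤ (p ⬝ᵥ M *ᵥ q) ^ 2

namespace ReverseCauchySchwarz

variable {ι : Type*} [Fintype ι] {M : Matrix ι ι ℝ}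

lemma dotProduct_mulVec_comm (hM : M.IsSymm) (p q : ι → ℝ) :
    p ⬝ᵥ M *ᵥ q = q ⬝ᵥ M *ᵥ p := by
  rw [dotProduct_comm, ← vecMul_transpose, hM.eq, ← dotProduct_mulVec]

lemma of_nonpos_on_hyperplane (hM : M.IsSymm) (w : ι → ℝ)
    (h : ∀ q, w ⬝ᵥ q = 0 → q ⬝ᵥ M *ᵥ q ≤ 0) : ReverseCauchySchwarz M := by
  intro p q hp
  have hw : w ⬝ᵥ p ≠ 0 := fun h0 => (h p h0).not_gt hp
  -- this combination of `p` and `q` lies in the hyperplane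
  have key := h ((w ⬝ᵥ q) • p - (w ⬝ᵥ p) • q) (by
    simp only [dotProduct_sub, dotProduct_smul, smul_eq_mul]; ring)
  simp only [mulVec_sub, mulVec_smul, sub_dotProduct, dotProduct_sub, smul_dotProduct,
    dotProduct_smul, smul_eq_mul, dotProduct_mulVec_comm hM q p] at key
  set a := p ⬝ᵥ M *ᵥ p
  set b := p ⬝ᵥ M *ᵥ q
  set c := q ⬝ᵥ M *ᵥ q
  set s := w ⬝ᵥ q
  set t := w ⬝ᵥ p
  by_contra! hlt
  have h1 : 0 < t ^ 2 * (a * c - b ^ 2) := mul_pos (by positivity) (by linarith)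
  nlinarith [sq_nonneg (a * s - b * t), mul_nonneg hp.le (neg_nonneg.2 key)]

lemma exists_hyperplane (hM : M.IsSymm) (h : ReverseCauchySchwarz M) :
    ∃ w : ι → ℝ, ∀ q, w ⬝ᵥ q = 0 → q ⬝ᵥ M *ᵥ q ≤ 0 := by
  by_cases hp : ∃ p, 0 < p ⬝ᵥ M *ᵥ p
  · obtain ⟨p, hp⟩ := hp
    refine ⟨M *ᵥ p, fun q hq => ?_⟩
    have h1 := h p q hp
    rw [dotProduct_mulVec_comm hM p q, dotProduct_comm q (M *ᵥ p), hq] at h1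
    by_contra! h2
    nlinarith [mul_pos hp h2]
  · push Not at hp
    exact ⟨0, fun q _ => hp q⟩

/-- A quadratic form whose nonzero entries lie in row or column `i` vanishes on the hyperplane where
coordinate `i` is zero. -/
lemma of_star (hM : M.IsSymm) (i : ι) (h : ∀ j k, j ≠ i → k ≠ i → M j k = 0) :
    ReverseCauchySchwarz M := by
  classical
  refine of_nonpos_on_hyperplane hM (Pi.single i 1) fun q hq => ?_
  rw [single_one_dotProduct] at hq
  refine (Finset.sum_eq_zero fun j _ => ?_).le
  by_cases hj : j = i
  · simp [hj, hq]
  refine mul_eq_zero_of_right _ (Finset.sum_eq_zero fun k _ => ?_)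
  by_cases hk : k = i
  · simp [hk, hq]
  · simp [h j k hj hk]

lemma sub_diagonal (hM : M.IsSymm) (h : ReverseCauchySchwarz M) [DecidableEq ι] {δ : ι → ℝ}
    (hδ : ∀ i, 0 ≤ δ i) : ReverseCauchySchwarz (M - diagonal δ) := by
  obtain ⟨w, hw⟩ := h.exists_hyperplane hM
  refine of_nonpos_on_hyperplane (hM.sub (isSymm_diagonal δ)) w fun q hq => ?_
  rw [sub_mulVec, dotProduct_sub]
  have : 0 ≤ q ⬝ᵥ diagonal δ *ᵥ q := by
    refine Finset.sum_nonneg fun i _ => ?_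
    rw [mulVec_diagonal]
    nlinarith [hδ i, mul_self_nonneg (q i), mul_nonneg (hδ i) (mul_self_nonneg (q i))]
  linarith [hw q hq]

lemma congruence {κ : Type*} [Fintype κ] (h : ReverseCauchySchwarz M) (P : Matrix ι κ ℝ) :
    ReverseCauchySchwarz (Pᵀ * M * P) := by
  have key (p q : κ → ℝ) : p ⬝ᵥ (Pᵀ * M * P) *ᵥ q = (P *ᵥ p) ⬝ᵥ M *ᵥ (P *ᵥ q) := by
    rw [← mulVec_mulVec, ← mulVec_mulVec, dotProduct_mulVec, vecMul_transpose]
  intro p q hp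
  simp only [key] at hp ⊢
  exact h _ _ hp

open Real in
/-- The inductive step from local to global. The `A k` play the role of the Hessians of the partial
derivatives `∂ₖ f` of a form `f` in a common direction, and `H = ∑ xₖ Aₖ` that of the Hessian of
`D_x f`; `hswap` expresses that third derivatives are symmetric, so that `Aₖ x` is row `k` of `H`.
The reverse Cauchy-Schwarz inequality of each `Aₖ` then yields
`⟨q, H q⟩ ≤ ∑ₖ xₖ (H q)ₖ² / (H x)ₖ`, which forces every eigenvalue `t` of the normalized matrix
`D H D`, `D² = diag (x / H x)`, to satisfy `t ≤ t²`. The Perron eigenvalue is `1`, and by `hconn` it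
is simple, so it is the only positive eigenvalue. -/
theorem sum_smul (A : ι → Matrix ι ι ℝ) (x : ι → ℝ) {H : Matrix ι ι ℝ}
    (hA : ∀ k, ReverseCauchySchwarz (A k)) (hnonneg : ∀ k i j, 0 ≤ A k i j)
    (hsymm : ∀ k, (A k).IsSymm) (hswap : ∀ k i j, A k i j = A i k j) (hx : ∀ i, 0 < x i)
    (hH : ∀ i j, H i j = ∑ k, x k * A k i j)
    (hconn : ∀ i j, (∃ k, H i k ≠ 0) → (∃ k, H j k ≠ 0) →
      ∃ h, (i = h ∨ H i h ≠ 0) ∧ (j = h ∨ H j h ≠ 0)) :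
    ReverseCauchySchwarz H := by
  classical
  have hHs : H.IsSymm := by
    ext i j
    simp only [transpose_apply, hH, (hsymm _).apply]
  have hH0 (i j) : 0 ≤ H i j := by
    rw [hH]; exact Finset.sum_nonneg fun k _ => mul_nonneg (hx k).le (hnonneg k i j)
  have hAx (k) : A k *ᵥ x = H k := by
    ext j
    simp only [mulVec, dotProduct, hH]
    refine Finset.sum_congr rfl fun i _ => ?_
    rw [mul_comm, ← (hsymm k).apply, hswap]
  set r : ι → ℝ := H *ᵥ x with hr
  have hr0 (i) : 0 ≤ r i := Finset.sum_nonneg fun j _ => mul_nonneg (hH0 i j) (hx j).le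
  have hrz {i} (hi : r i = 0) (j) : H i j = 0 := by
    have := (Finset.sum_eq_zero_iff_of_nonneg
      (fun j _ => mul_nonneg (hH0 i j) (hx j).le)).1 hi j (Finset.mem_univ _)
    exact (mul_eq_zero.1 this).resolve_right (hx j).ne'
  have hAz {k} (hk : r k = 0) (i j) : A k i j = 0 := by
    have h1 : H k j = 0 := hrz hk j
    rw [hH] at h1
    have := (Finset.sum_eq_zero_iff_of_nonneg
      (fun l _ => mul_nonneg (hx l).le (hnonneg l k j))).1 h1 i (Finset.mem_univ _)
    rw [hswap]
    exact (mul_eq_zero.1 this).resolve_left (hx i).ne'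
  have hboch (q : ι → ℝ) : q ⬝ᵥ H *ᵥ q ≤ ∑ k, x k / r k * (H *ᵥ q) k ^ 2 := by
    have h1 : q ⬝ᵥ H *ᵥ q = ∑ k, x k * (q ⬝ᵥ A k *ᵥ q) := by
      simp only [dotProduct, mulVec, hH, Finset.sum_mul, Finset.mul_sum]
      rw [Finset.sum_comm_cycle]
      exact Finset.sum_congr rfl fun k _ => Finset.sum_congr rfl fun i _ =>
        Finset.sum_congr rfl fun j _ => by ring
    rw [h1]
    refine Finset.sum_le_sum fun k _ => ?_
    have hq : (H *ᵥ q) k = x ⬝ᵥ A k *ᵥ q := by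
      rw [dotProduct_mulVec_comm (hsymm k), hAx, dotProduct_comm]; rfl
    have hxx : x ⬝ᵥ A k *ᵥ x = r k := by
      rw [hAx, dotProduct_comm]; rfl
    rcases (hr0 k).eq_or_lt with h0 | h0
    · have : q ⬝ᵥ A k *ᵥ q = 0 := by simp [dotProduct, mulVec, hAz h0.symm]
      simp [this, ← h0]
    · have h2 := hA k x q (by rw [hxx]; exact h0)
      rw [hxx, ← hq] at h2
      rw [div_mul_eq_mul_div, mul_div_assoc]
      refine mul_le_mul_of_nonneg_left ?_ (hx k).le
      rw [le_div_iff₀ h0]; linarith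
  -- the Dirichlet form bounds the spectrum of the normalized matrix by `1`
  have hdir (q : ι → ℝ) : ∑ i, ∑ j, H i j * (x i * x j) * (q i / x i - q j / x j) ^ 2 =
      2 * (∑ i, r i / x i * q i ^ 2) - 2 * (q ⬝ᵥ H *ᵥ q) := by
    have e1 (i j) : H i j * (x i * x j) * (q i / x i - q j / x j) ^ 2 =
        H i j * x j * (1 / x i * q i ^ 2) + H j i * x i * (1 / x j * q j ^ 2)
          - 2 * (q i * (H i j * q j)) := by
      have := (hx i).ne'
      have := (hx j).ne'
      rw [hHs.apply]
      field_simp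
      ring
    simp only [e1, Finset.sum_sub_distrib, Finset.sum_add_distrib]
    have e2 : ∑ i, ∑ j, H i j * x j * (1 / x i * q i ^ 2) = ∑ i, r i / x i * q i ^ 2 := by
      refine Finset.sum_congr rfl fun i _ => ?_
      rw [← Finset.sum_mul, hr]
      simp only [mulVec, dotProduct]
      ring
    rw [Finset.sum_comm (f := fun i j => H j i * x i * (1 / x j * q j ^ 2)), e2]
    have e3 : ∑ i, ∑ j, 2 * (q i * (H i j * q j)) = 2 * (q ⬝ᵥ H *ᵥ q) := by
      simp only [dotProduct, mulVec, Finset.mul_sum]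
    rw [e3]
    ring
  set D : ι → ℝ := fun i => √(x i / r i) with hD
  set E : ι → ℝ := fun i => √(r i / x i) with hE
  have hD2 (i) : D i ^ 2 = x i / r i := sq_sqrt (div_nonneg (hx i).le (hr0 i))
  have hE2 (i) : E i ^ 2 = r i / x i := sq_sqrt (div_nonneg (hr0 i) (hx i).le)
  have hDE {i} (hi : r i ≠ 0) : D i * E i = 1 := by
    have := (hx i).ne'
    rw [hD, hE, ← sqrt_mul (div_nonneg (hx i).le (hr0 i))]
    field_simp
    exact sqrt_one
  set N : Matrix ι ι ℝ := of fun i j => D i * H i j * D j with hN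
  have hNmul (v : ι → ℝ) (k) : (N *ᵥ v) k = D k * (H *ᵥ (D * v)) k := by
    simp only [hN, mulVec, dotProduct, of_apply, Finset.mul_sum, Pi.mul_apply]
    exact Finset.sum_congr rfl fun j _ => by ring
  have hNquad (v : ι → ℝ) : v ⬝ᵥ N *ᵥ v = (D * v) ⬝ᵥ H *ᵥ (D * v) := by
    simp only [dotProduct, hNmul, Pi.mul_apply]
    exact Finset.sum_congr rfl fun j _ => by ring
  have hNs : N.IsSymm := by
    ext i j
    simp only [hN, transpose_apply, of_apply, hHs.apply i j]; ring
  have hNh : N.IsHermitian := by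
    rw [IsHermitian, conjTranspose_eq_transpose_of_trivial]; exact hNs
  -- Where `r i = 0`, `D i` and `E i` vanish by the convention `x / 0 = 0`, as do the rows of `H`.
  -- An eigenvector for a positive eigenvalue is a multiple of the Perron vector `E * x`.
  have heig (v : ι → ℝ) (t : ℝ) (hv : v ⬝ᵥ v = 1) (ht : 0 < t) (hNv : N *ᵥ v = t • v) :
      ∃ c : ℝ, v = c • (E * x) := by
    have hvz {i} (hi : r i = 0) : v i = 0 := by
      have h1 := congrFun hNv i
      rw [hNmul] at h1
      simp only [hD, hi, div_zero, sqrt_zero, zero_mul, Pi.smul_apply, smul_eq_mul] at h1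
      exact (mul_eq_zero.1 h1.symm).resolve_left ht.ne'
    have hvq (i) : v i = E i * (D * v) i := by
      by_cases hi : r i = 0
      · simp [hvz hi]
      · rw [Pi.mul_apply, ← mul_assoc, mul_comm (E i), hDE hi, one_mul]
    have hq1 : (D * v) ⬝ᵥ H *ᵥ (D * v) = t := by
      rw [← hNquad, hNv, dotProduct_smul, hv, smul_eq_mul, mul_one]
    have ht1 : 1 ≤ t := by
      have h1 := hboch (D * v)
      have h2 : ∑ k, x k / r k * (H *ᵥ (D * v)) k ^ 2 = t ^ 2 := by
        calc _ = ∑ k, t ^ 2 * (v k * v k) := Finset.sum_congr rfl fun k _ => by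
              rw [← hD2, ← mul_pow, ← hNmul, hNv, Pi.smul_apply, smul_eq_mul]; ring
          _ = t ^ 2 * (v ⬝ᵥ v) := by rw [← Finset.mul_sum]; rfl
          _ = t ^ 2 := by rw [hv, mul_one]
      rw [h2, hq1] at h1
      nlinarith
    have hq2 : ∑ i, r i / x i * (D * v) i ^ 2 = 1 := by
      rw [← hv]
      refine Finset.sum_congr rfl fun i _ => ?_
      rw [← hE2, ← mul_pow, ← hvq, sq]
    have hd := hdir (D * v)
    rw [hq1, hq2] at hd
    have hterm (i j) :
        0 ≤ H i j * (x i * x j) * ((D * v) i / x i - (D * v) j / x j) ^ 2 :=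
      mul_nonneg (mul_nonneg (hH0 i j) (mul_pos (hx i) (hx j)).le) (sq_nonneg _)
    have hzero : ∑ i, ∑ j, H i j * (x i * x j) * ((D * v) i / x i - (D * v) j / x j) ^ 2 = 0 :=
      le_antisymm (by linarith) (Finset.sum_nonneg fun i _ => Finset.sum_nonneg fun j _ => hterm i j)
    have heq {i j} (hij : H i j ≠ 0) : (D * v) i / x i = (D * v) j / x j := by
      have h1 := (Finset.sum_eq_zero_iff_of_nonneg
        fun i _ => Finset.sum_nonneg fun j _ => hterm i j).1 hzero i (Finset.mem_univ _)
      have h2 := (Finset.sum_eq_zero_iff_of_nonneg fun j _ => hterm i j).1 h1 j (Finset.mem_univ _)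
      have h3 := (mul_eq_zero.1 h2).resolve_left
        (mul_ne_zero hij (mul_pos (hx i) (hx j)).ne')
      exact sub_eq_zero.1 (pow_eq_zero_iff two_ne_zero |>.1 h3)
    have hrow {i} (hi : r i ≠ 0) : ∃ k, H i k ≠ 0 := by
      by_contra! h
      exact hi (Finset.sum_eq_zero fun j _ => mul_eq_zero_of_left (h j) _)
    have hall {i j} (hi : r i ≠ 0) (hj : r j ≠ 0) : (D * v) i / x i = (D * v) j / x j := by
      obtain ⟨h, h1, h2⟩ := hconn i j (hrow hi) (hrow hj)
      have e1 : (D * v) i / x i = (D * v) h / x h := h1.elim (fun e => by rw [e]) heq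
      have e2 : (D * v) j / x j = (D * v) h / x h := h2.elim (fun e => by rw [e]) heq
      rw [e1, e2]
    by_cases hS : ∃ i, r i ≠ 0
    · obtain ⟨i, hi⟩ := hS
      refine ⟨(D * v) i / x i, funext fun j => ?_⟩
      rw [Pi.smul_apply, smul_eq_mul, Pi.mul_apply E x]
      by_cases hj : r j = 0
      · simp [hvz hj, hE, hj]
      · rw [hall hi hj]
        conv_lhs => rw [hvq]
        have := (hx j).ne'
        field_simp
    · push Not at hS
      exact ⟨0, funext fun j => by simp [hvz (hS j)]⟩
  have hNneg (v : ι → ℝ) (hv : (E * x) ⬝ᵥ v = 0) : v ⬝ᵥ N *ᵥ v ≤ 0 := by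
    set b := hNh.eigenvectorBasis
    have h1 := b.sum_inner_mul_inner (WithLp.toLp 2 v) (WithLp.toLp 2 (N *ᵥ v))
    have h2 : inner ℝ (WithLp.toLp 2 v) (WithLp.toLp 2 (N *ᵥ v)) = v ⬝ᵥ N *ᵥ v := by
      rw [EuclideanSpace.inner_eq_star_dotProduct, dotProduct_comm]; simp
    rw [← h2, ← h1]
    refine Finset.sum_nonpos fun k _ => ?_
    have hb := hNh.mulVec_eigenvectorBasis k
    have e1 : inner ℝ (WithLp.toLp 2 v) (b k) = (b k).ofLp ⬝ᵥ v := by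
      rw [EuclideanSpace.inner_eq_star_dotProduct]; simp
    have e2 : inner ℝ (b k) (WithLp.toLp 2 (N *ᵥ v)) = hNh.eigenvalues k * ((b k).ofLp ⬝ᵥ v) := by
      rw [EuclideanSpace.inner_eq_star_dotProduct, dotProduct_comm]
      simp only [star_trivial]
      rw [dotProduct_mulVec_comm hNs, hb, dotProduct_smul, dotProduct_comm, smul_eq_mul]
    rw [e1, e2]
    by_cases ht : 0 < hNh.eigenvalues k
    · obtain ⟨c, hc⟩ := heig (b k).ofLp _ (by
        have := b.orthonormal.1 k
        have h3 : inner ℝ (b k) (b k) = (1 : ℝ) := by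
          rw [real_inner_self_eq_norm_sq, this, one_pow]
        rw [EuclideanSpace.inner_eq_star_dotProduct] at h3
        simpa using h3) ht hb
      rw [hc, smul_dotProduct, hv]; simp
    · push Not at ht
      nlinarith [mul_self_nonneg ((b k).ofLp ⬝ᵥ v),
        mul_nonneg (neg_nonneg.2 ht) (mul_self_nonneg ((b k).ofLp ⬝ᵥ v))]
  refine of_nonpos_on_hyperplane hHs r fun q hq => ?_
  have h1 : q ⬝ᵥ H *ᵥ q = (E * q) ⬝ᵥ N *ᵥ (E * q) := by
    simp only [dotProduct, mulVec, hN, of_apply, Pi.mul_apply, Finset.mul_sum]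
    refine Finset.sum_congr rfl fun i _ => Finset.sum_congr rfl fun j _ => ?_
    by_cases hi : r i = 0
    · simp [hrz hi]
    by_cases hj : r j = 0
    · rw [← hHs.apply]; simp [hrz hj]
    calc q i * (H i j * q j) = (D i * E i) * (D j * E j) * (q i * (H i j * q j)) := by
          rw [hDE hi, hDE hj]; ring
      _ = _ := by ring
  rw [h1]
  refine hNneg _ ?_
  rw [← hq]
  refine Finset.sum_congr rfl fun i _ => ?_
  have h2 := hE2 i
  have h3 := (hx i).ne'
  calc E i * x i * (E i * q i) = E i ^ 2 * x i * q i := by ring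
    _ = r i * q i := by rw [h2, div_mul_cancel₀ _ h3]

end ReverseCauchySchwarz

/-! ### Directional derivatives and the local-to-global principle -/

section Contraction

variable {ι : Type*} [Fintype ι]

/-- A form `f` in variables indexed by `ι` is encoded by the function `c` sending a multiset
`{i₁, …, iₘ}` to the iterated partial derivative `∂_{i₁} ⋯ ∂_{iₘ} f` at the origin. In this encoding
`dirDeriv x` is the directional derivative `∑ xᵢ ∂ᵢ`. -/
def dirDeriv (x : ι → ℝ) (c : Multiset ι → ℝ) : Multiset ι → ℝ :=
  fun m => ∑ i, x i * c (i ::ₘ m)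

instance dirDeriv.leftCommutative : LeftCommutative (dirDeriv (ι := ι)) where
  left_comm x y c := by
    funext m
    simp only [dirDeriv, Finset.mul_sum]
    rw [Finset.sum_comm]
    exact Finset.sum_congr rfl fun i _ => Finset.sum_congr rfl fun j _ => by
      rw [Multiset.cons_swap]; ring

/-- The iterated directional derivative along all the vectors of `s`, in the encoding of `dirDeriv`.
The order of the vectors does not matter, whence a multiset. -/
def contract (s : Multiset (ι → ℝ)) (c : Multiset ι → ℝ) : Multiset ι → ℝ :=
  s.foldr dirDeriv c

@[simp] lemma contract_zero (c : Multiset ι → ℝ) : contract 0 c = c := rfl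

lemma contract_cons (x : ι → ℝ) (s : Multiset (ι → ℝ)) (c : Multiset ι → ℝ) (m : Multiset ι) :
    contract (x ::ₘ s) c m = ∑ i, x i * contract s c (i ::ₘ m) := by
  rw [contract, Multiset.foldr_cons]; rfl

lemma contract_nonneg {c : Multiset ι → ℝ} (hc : ∀ m, 0 ≤ c m) {s : Multiset (ι → ℝ)}
    (hs : ∀ x ∈ s, ∀ i, 0 ≤ x i) (m : Multiset ι) : 0 ≤ contract s c m := by
  induction s using Multiset.induction generalizing m with
  | empty => exact hc m
  | cons x s ih =>
    rw [contract_cons]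
    exact Finset.sum_nonneg fun i _ => mul_nonneg (hs x (Multiset.mem_cons_self x s) i)
      (ih (fun y hy => hs y (Multiset.mem_cons_of_mem hy)) _)

lemma contract_ne_zero_iff {c : Multiset ι → ℝ} (hc : ∀ m, 0 ≤ c m) {s : Multiset (ι → ℝ)}
    (hs : ∀ x ∈ s, ∀ i, 0 < x i) (m : Multiset ι) :
    contract s c m ≠ 0 ↔ ∃ γ : Multiset ι, γ.card = s.card ∧ c (γ + m) ≠ 0 := by
  induction s using Multiset.induction generalizing m with
  | empty => simp
  | cons x s ih =>
    have hs' : ∀ y ∈ s, ∀ i, 0 < y i := fun y hy => hs y (Multiset.mem_cons_of_mem hy)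
    have hx := hs x (Multiset.mem_cons_self x s)
    rw [contract_cons, Ne, Finset.sum_eq_zero_iff_of_nonneg fun i _ => mul_nonneg (hx i).le
      (contract_nonneg hc (fun y hy i => (hs' y hy i).le) _)]
    push Not
    constructor
    · rintro ⟨i, -, hi⟩
      obtain ⟨γ, hγ, h⟩ := (ih hs' _).1 (right_ne_zero_of_mul hi)
      exact ⟨i ::ₘ γ, by simp [hγ], by rwa [Multiset.cons_add, ← Multiset.add_cons]⟩
    · rintro ⟨γ, hγ, h⟩
      rw [Multiset.card_cons] at hγ
      obtain ⟨i, hi⟩ := Multiset.card_pos_iff_exists_mem.1 (show 0 < γ.card by omega)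
      obtain ⟨γ, rfl⟩ := Multiset.exists_cons_of_mem hi
      refine ⟨i, Finset.mem_univ _, mul_ne_zero (hx i).ne' ((ih hs' _).2 ⟨γ, ?_, ?_⟩)⟩
      · simpa using hγ
      · rwa [Multiset.add_cons, ← Multiset.cons_add]

/-- The Hessian at the origin of the partial derivative `∂^m f` of the form encoded by `c`. -/
def hessian {ι : Type*} (c : Multiset ι → ℝ) (m : Multiset ι) : Matrix ι ι ℝ :=
  of fun i j => c (i ::ₘ j ::ₘ m)

lemma hessian_apply {ι : Type*} (c : Multiset ι → ℝ) (m : Multiset ι) (i j : ι) :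
    hessian c m i j = c (i ::ₘ j ::ₘ m) := rfl

lemma hessian_isSymm {ι : Type*} (c : Multiset ι → ℝ) (m : Multiset ι) : (hessian c m).IsSymm := by
  ext i j
  rw [transpose_apply, hessian_apply, hessian_apply, Multiset.cons_swap]

lemma dotProduct_hessian_mulVec (c : Multiset ι → ℝ) (m : Multiset ι) (p q : ι → ℝ) :
    p ⬝ᵥ hessian c m *ᵥ q = contract {p, q} c m := by
  rw [Multiset.insert_eq_cons, ← Multiset.cons_zero q, contract_cons]
  simp only [dotProduct, mulVec, hessian_apply]
  refine Finset.sum_congr rfl fun i _ => ?_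
  rw [contract_cons]
  congr 1
  refine Finset.sum_congr rfl fun j _ => ?_
  rw [contract_zero, Multiset.cons_swap, mul_comm]

lemma contract_add (s t : Multiset (ι → ℝ)) (c : Multiset ι → ℝ) :
    contract (s + t) c = contract s (contract t c) := by
  rw [contract, Multiset.foldr_add]; rfl

/-- The support of `c` in degree `d` is M-convex: it satisfies the exchange axiom of discrete convex
analysis. -/
def HasExchange {ι : Type*} (c : Multiset ι → ℝ) (d : ℕ) [DecidableEq ι] : Prop :=
  ∀ α β : Multiset ι, α.card = d → β.card = d → c α ≠ 0 → c β ≠ 0 →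
    ∀ a, β.count a < α.count a → ∃ b, α.count b < β.count b ∧ c (b ::ₘ α.erase a) ≠ 0

/-- The exchange axiom makes the graph of nonzero entries of the Hessian of a positive directional
derivative connected, with any two non-isolated vertices at distance at most two. -/
lemma HasExchange.exists_common [DecidableEq ι] {c : Multiset ι → ℝ} {d : ℕ}
    (hc : ∀ m, 0 ≤ c m) (hex : HasExchange c (d + 2)) {s : Multiset (ι → ℝ)}
    (hs : ∀ x ∈ s, ∀ i, 0 < x i) {m : Multiset ι} (hd : s.card + m.card = d) (i j : ι)
    (hi : ∃ k, hessian (contract s c) m i k ≠ 0) (hj : ∃ k, hessian (contract s c) m j k ≠ 0) :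
    ∃ h, (i = h ∨ hessian (contract s c) m i h ≠ 0) ∧
      (j = h ∨ hessian (contract s c) m j h ≠ 0) := by
  simp only [hessian_apply, contract_ne_zero_iff hc hs] at hi hj ⊢
  -- Every monomial in the support that contains `i` and `h` joins `i` to `h`.
  have key (i h : ι) (α : Multiset ι) (hα : α.card = s.card + 2) (hcα : c (α + m) ≠ 0)
      (hi : i ∈ α) (hh : h ∈ α) :
      i = h ∨ ∃ γ : Multiset ι, γ.card = s.card ∧ c (γ + i ::ₘ h ::ₘ m) ≠ 0 := by
    by_cases hih : i = h
    · exact Or.inl hih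
    obtain ⟨α, rfl⟩ := Multiset.exists_cons_of_mem hi
    obtain ⟨α, rfl⟩ := Multiset.exists_cons_of_mem
      ((Multiset.mem_cons.1 hh).resolve_left (Ne.symm hih))
    refine Or.inr ⟨α, by simpa using hα, ?_⟩
    simpa [Multiset.add_cons, Multiset.cons_add] using hcα
  obtain ⟨i', γ, hγ, hcγ⟩ := hi
  obtain ⟨j', δ, hδ, hcδ⟩ := hj
  have eα : γ + i ::ₘ i' ::ₘ m = (i ::ₘ i' ::ₘ γ) + m := by
    simp [Multiset.add_cons, Multiset.cons_add]
  have eβ : δ + j ::ₘ j' ::ₘ m = (j ::ₘ j' ::ₘ δ) + m := by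
    simp [Multiset.add_cons, Multiset.cons_add]
  rw [eα] at hcγ
  rw [eβ] at hcδ
  set α := i ::ₘ i' ::ₘ γ with hα
  set β := j ::ₘ j' ::ₘ δ with hβ
  have cα : α.card = s.card + 2 := by simp [hα, hγ]
  have cβ : β.card = s.card + 2 := by simp [hβ, hδ]
  have iα : i ∈ α := Multiset.mem_cons_self _ _
  have jβ : j ∈ β := Multiset.mem_cons_self _ _
  by_cases hdis : ∃ h, h ∈ α ∧ h ∈ β
  · obtain ⟨h, h1, h2⟩ := hdis
    exact ⟨h, key i h α cα hcγ iα h1, key j h β cβ hcδ jβ h2⟩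
  -- Two disjoint monomials: exchanging `i'`, and not `i`, against some `b` of the other one leaves
  -- a monomial that contains both `i` and `b`.
  · push Not at hdis
    have hi' : i' ∈ α := by simp [hα]
    obtain ⟨b, hb, hcb⟩ := hex (α + m) (β + m) (by simp [cα]; omega) (by simp [cβ]; omega)
      hcγ hcδ i' (by
        rw [Multiset.count_add, Multiset.count_add, Multiset.count_eq_zero.2 (hdis _ hi')]
        have := Multiset.count_pos.2 hi'
        omega)
    rw [Multiset.count_add, Multiset.count_add] at hb
    have hbβ : b ∈ β := Multiset.count_pos.1 (by omega)
    rw [Multiset.erase_add_left_pos _ hi', ← Multiset.cons_add] at hcb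
    refine ⟨b, key i b (b ::ₘ α.erase i') ?_ hcb ?_ (Multiset.mem_cons_self _ _),
      key j b β cβ hcδ jβ hbβ⟩
    · rw [Multiset.card_cons, Multiset.card_erase_of_mem hi', cα]; rfl
    · refine Multiset.mem_cons_of_mem ?_
      rw [hα, Multiset.cons_swap, Multiset.erase_cons_head]
      exact Multiset.mem_cons_self _ _

theorem reverseCauchySchwarz_hessian_contract_of_pos [DecidableEq ι] {c : Multiset ι → ℝ} {d : ℕ}
    (hc : ∀ m, 0 ≤ c m) (hex : HasExchange c (d + 2))
    (hloc : ∀ m : Multiset ι, m.card = d → ReverseCauchySchwarz (hessian c m))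
    {s : Multiset (ι → ℝ)} (hs : ∀ x ∈ s, ∀ i, 0 < x i) {m : Multiset ι}
    (hd : s.card + m.card = d) : ReverseCauchySchwarz (hessian (contract s c) m) := by
  induction s using Multiset.induction generalizing m with
  | empty => exact hloc m (by simpa using hd)
  | cons x s ih =>
    have hs' : ∀ y ∈ s, ∀ i, 0 < y i := fun y hy => hs y (Multiset.mem_cons_of_mem hy)
    rw [Multiset.card_cons] at hd
    refine ReverseCauchySchwarz.sum_smul (fun k => hessian (contract s c) (k ::ₘ m)) x
      (fun k => ih hs' (by simp; omega))
      (fun k i j => contract_nonneg hc (fun y hy i => (hs' y hy i).le) _)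
      (fun k => hessian_isSymm _ _) (fun k i j => ?_) (hs x (Multiset.mem_cons_self x s))
      (fun i j => ?_) (hex.exists_common hc hs (by simp; omega))
    · simp only [hessian_apply]
      rw [Multiset.cons_swap j k, Multiset.cons_swap i k, Multiset.cons_swap j i]
    · simp only [hessian_apply, contract_cons]
      refine Finset.sum_congr rfl fun k _ => ?_
      rw [Multiset.cons_swap k i, Multiset.cons_swap k j]

lemma continuous_contract_map_add (s : Multiset (ι → ℝ)) (c : Multiset ι → ℝ) (m : Multiset ι) :
    Continuous fun ε : ℝ => contract (s.map fun x i => x i + ε) c m := by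
  induction s using Multiset.induction generalizing m with
  | empty => exact continuous_const
  | cons x s ih =>
    simp only [Multiset.map_cons, contract_cons]
    exact continuous_finsetSum _ fun i _ => (continuous_const.add continuous_id).mul (ih _)

/-- The local-to-global principle: if a form of degree `d + 2` has nonnegative coefficients and
M-convex support, and its partial derivatives of order `d` are Lorentzian quadratic forms, then so
are its derivatives of order `d` along nonnegative vectors. It follows from the case of positive
vectors by passing to the limit. -/
theorem reverseCauchySchwarz_hessian_contract [DecidableEq ι] {c : Multiset ι → ℝ} {d : ℕ}
    (hc : ∀ m, 0 ≤ c m) (hex : HasExchange c (d + 2))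
    (hloc : ∀ m : Multiset ι, m.card = d → ReverseCauchySchwarz (hessian c m))
    {s : Multiset (ι → ℝ)} (hs : ∀ x ∈ s, ∀ i, 0 ≤ x i) {m : Multiset ι}
    (hd : s.card + m.card = d) : ReverseCauchySchwarz (hessian (contract s c) m) := by
  intro p q hp
  set F : (ι → ℝ) → (ι → ℝ) → ℝ → ℝ := fun p q ε =>
    p ⬝ᵥ hessian (contract (s.map fun x i => x i + ε) c) m *ᵥ q with hF
  have hcont (p q : ι → ℝ) : Continuous (F p q) := by
    simp only [hF, dotProduct, mulVec, hessian_apply]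
    exact continuous_finsetSum _ fun i _ => continuous_const.mul
      (continuous_finsetSum _ fun j _ => (continuous_contract_map_add s c _).mul continuous_const)
  have h0 (p q : ι → ℝ) : F p q 0 = p ⬝ᵥ hessian (contract s c) m *ᵥ q := by
    simp [hF]
  have hpos : ∀ᶠ ε in nhdsWithin (0 : ℝ) (Set.Ioi 0), 0 < F p p ε :=
    ((hcont p p).tendsto 0).mono_left nhdsWithin_le_nhds |>.eventually_const_lt (by rwa [h0])
  have hle : ∀ᶠ ε in nhdsWithin (0 : ℝ) (Set.Ioi 0), F p p ε * F q q ε ≤ F p q ε ^ 2 := by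
    filter_upwards [hpos, self_mem_nhdsWithin] with ε h1 h2
    refine reverseCauchySchwarz_hessian_contract_of_pos hc hex hloc ?_ (by simpa using hd) p q h1
    intro x hx i
    obtain ⟨y, hy, rfl⟩ := Multiset.mem_map.1 hx
    exact add_pos_of_nonneg_of_pos (hs y hy i) h2
  simp only [← h0]
  exact le_of_tendsto_of_tendsto
    ((((hcont p p).mul (hcont q q)).tendsto 0).mono_left nhdsWithin_le_nhds)
    ((((hcont p q).pow 2).tendsto 0).mono_left nhdsWithin_le_nhds) hle

lemma univ_val_map_fin_succ {α : Type*} {n : ℕ} (f : Fin (n + 1) → α) :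
    Finset.univ.val.map f = f 0 ::ₘ Finset.univ.val.map (f ∘ Fin.succ) := by
  rw [Fin.univ_val_map, Fin.univ_val_map, List.ofFn_succ]; rfl

lemma univ_val_map_equiv {α σ τ : Type*} [Fintype σ] [Fintype τ] (e : σ ≃ τ) (f : τ → α) :
    Finset.univ.val.map (f ∘ e) = Finset.univ.val.map f := by
  rw [← Multiset.map_map, ← Finset.map_univ_equiv e]; rfl

lemma contract_univ_map_fin {n : ℕ} (X : Fin n → ι → ℝ) (c : Multiset ι → ℝ) (m : Multiset ι) :
    contract (Finset.univ.val.map X) c m =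
      ∑ f : Fin n → ι, (∏ t, X t (f t)) * c (Finset.univ.val.map f + m) := by
  induction n generalizing m with
  | zero => simp
  | succ n ih =>
    rw [univ_val_map_fin_succ, contract_cons, ← (Fin.consEquiv fun _ => ι).sum_comp,
      Fintype.sum_prod_type]
    refine Finset.sum_congr rfl fun i _ => ?_
    rw [ih, Finset.mul_sum]
    refine Finset.sum_congr rfl fun f _ => ?_
    rw [univ_val_map_fin_succ, Fin.prod_univ_succ, Multiset.cons_add, ← Multiset.add_cons]
    simp [Fin.consEquiv, Function.comp_def, mul_assoc]

lemma contract_univ_map {τ : Type*} [Fintype τ] [DecidableEq τ] (X : τ → ι → ℝ)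
    (c : Multiset ι → ℝ) (m : Multiset ι) :
    contract (Finset.univ.val.map X) c m =
      ∑ f : τ → ι, (∏ t, X t (f t)) * c (Finset.univ.val.map f + m) := by
  have e := (Fintype.equivFin τ).symm
  rw [← univ_val_map_equiv e, contract_univ_map_fin, ← (e.arrowCongr (Equiv.refl ι)).sum_comp]
  refine Finset.sum_congr rfl fun f _ => ?_
  rw [← univ_val_map_equiv e, ← e.prod_comp]
  simp [Function.comp_def]

end Contraction

/-! ### Truncation to bounded exponents -/

section Truncation

variable {ι : Type*} [DecidableEq ι]

/-- All multiplicities in the multiset `m` lie between the bounds `l` and `u`. -/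
def InBounds (l u : ι → ℕ) (m : Multiset ι) : Prop :=
  ∀ j, l j ≤ m.count j ∧ m.count j ≤ u j

open Classical in
/-- The form obtained from the one encoded by `c` by discarding the monomials whose exponents are
not within the bounds. -/
noncomputable def truncate (l u : ι → ℕ) (c : Multiset ι → ℝ) (m : Multiset ι) : ℝ :=
  if InBounds l u m then c m else 0

lemma truncate_nonneg {l u : ι → ℕ} {c : Multiset ι → ℝ} (hc : ∀ m, 0 ≤ c m) (m : Multiset ι) :
    0 ≤ truncate l u c m := by
  rw [truncate]; split_ifs
  exacts [hc m, le_rfl]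

lemma truncate_ne_zero_iff {l u : ι → ℕ} {c : Multiset ι → ℝ} {m : Multiset ι} :
    truncate l u c m ≠ 0 ↔ InBounds l u m ∧ c m ≠ 0 := by
  rw [truncate]; split_ifs with h <;> simp [h]

lemma HasExchange.truncate {l u : ι → ℕ} {c : Multiset ι → ℝ} {d : ℕ} (h : HasExchange c d) :
    HasExchange (truncate l u c) d := by
  intro α β hα hβ hcα hcβ a ha
  rw [truncate_ne_zero_iff] at hcα hcβ
  obtain ⟨b, hb, hcb⟩ := h α β hα hβ hcα.2 hcβ.2 a ha
  refine ⟨b, hb, truncate_ne_zero_iff.2 ⟨fun j => ?_, hcb⟩⟩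
  have h1 := hcα.1 j
  have h2 := hcβ.1 j
  rw [Multiset.count_cons]
  by_cases hja : j = a
  · subst hja
    have hjb : j ≠ b := by rintro rfl; omega
    rw [Multiset.count_erase_self, if_neg hjb]
    omega
  · rw [Multiset.count_erase_of_ne hja]
    split_ifs with hjb
    · subst hjb; omega
    · omega

lemma reverseCauchySchwarz_hessian_truncate [Fintype ι] {l u : ι → ℕ} {c : Multiset ι → ℝ}
    (hc : ∀ m, 0 ≤ c m) {m : Multiset ι} (h : ReverseCauchySchwarz (hessian c m)) :
    ReverseCauchySchwarz (hessian (truncate l u c) m) := by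
  -- One index short of its lower bound leaves only its own row and column.
  by_cases hl : ∃ i, m.count i < l i
  · obtain ⟨i, hi⟩ := hl
    refine .of_star (hessian_isSymm _ _) i fun j k hj hk => ?_
    rw [hessian_apply, truncate, if_neg]
    intro hb
    have := (hb i).1
    rw [Multiset.count_cons_of_ne hj.symm, Multiset.count_cons_of_ne hk.symm] at this
    omega
  by_cases hu : ∃ i, u i < m.count i
  · obtain ⟨i, hi⟩ := hu
    refine .of_star (hessian_isSymm _ _) i fun j k hj hk => ?_
    rw [hessian_apply, truncate, if_neg]
    intro hb
    have := (hb i).2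
    rw [Multiset.count_cons_of_ne hj.symm, Multiset.count_cons_of_ne hk.symm] at this
    omega
  push Not at hl hu
  -- Otherwise the upper bounds delete the variables with `z i = 0` and, for the indices one short
  -- of their bound, the diagonal entry `δ i`.
  set z : ι → ℝ := fun i => if m.count i < u i then 1 else 0 with hz
  set δ : ι → ℝ := fun i => if m.count i + 1 = u i then c (i ::ₘ i ::ₘ m) else 0 with hδ
  have key : hessian (truncate l u c) m =
      (diagonal z)ᵀ * hessian c m * diagonal z - diagonal δ := by
    ext i j
    rw [Matrix.sub_apply, diagonal_transpose, mul_diagonal, diagonal_mul, diagonal_apply,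
      hessian_apply, hessian_apply, truncate]
    by_cases hij : i = j
    · subst hij
      have hb : InBounds l u (i ::ₘ i ::ₘ m) ↔ m.count i + 2 ≤ u i := by
        refine ⟨fun hb => by have := (hb i).2; simp at this; omega, fun hb k => ?_⟩
        have := hl k
        have := hu k
        simp only [Multiset.count_cons]
        by_cases hk : k = i
        · subst hk; simp; omega
        · simp [hk]; omega
      have := hu i
      simp only [hb, hz, hδ, if_true]
      split_ifs <;> first | omega | simp
    · have hb : InBounds l u (i ::ₘ j ::ₘ m) ↔ m.count i < u i ∧ m.count j < u j := by
        refine ⟨fun hb => ⟨?_, ?_⟩, fun hb k => ?_⟩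
        · have := (hb i).2
          simp [hij] at this; omega
        · have := (hb j).2
          simp [Ne.symm hij] at this; omega
        · have := hl k
          have := hu k
          simp only [Multiset.count_cons]
          by_cases hk : k = i
          · subst hk; simp [hij]; omega
          · by_cases hk' : k = j
            · subst hk'; simp [hk]; omega
            · simp [hk, hk']; omega
      simp only [hb, hz, if_neg hij]
      by_cases h1 : m.count i < u i <;> by_cases h2 : m.count j < u j <;> simp [h1, h2]
  rw [key]
  refine ReverseCauchySchwarz.sub_diagonal ?_ (h.congruence _) fun i => ?_
  · rw [IsSymm, transpose_mul, transpose_mul, transpose_transpose, (hessian_isSymm c m).eq,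
      Matrix.mul_assoc]
  · simp only [hδ]; split_ifs
    exacts [hc _, le_rfl]

end Truncation

/-! ### Permanents and products of linear forms -/

section Permanent

variable {V ι : Type*} [Fintype V] [DecidableEq V]

/-- The coefficients of the form `∏ v, z v` in variables indexed by `V`. -/
def squarefreeCoeff (V : Type*) [Fintype V] [DecidableEq V] (m : Multiset V) : ℝ :=
  if m = Finset.univ.val then 1 else 0

lemma squarefreeCoeff_nonneg (m : Multiset V) : 0 ≤ squarefreeCoeff V m := by
  rw [squarefreeCoeff]; split_ifs <;> norm_num

lemma squarefreeCoeff_map (σ : V → V) :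
    squarefreeCoeff V (Finset.univ.val.map σ) = if σ.Bijective then 1 else 0 := by
  rw [squarefreeCoeff]
  refine if_congr ⟨fun h => ?_, fun h => ?_⟩ rfl rfl
  · refine Finite.injective_iff_bijective.1 fun v w hvw => ?_
    exact Multiset.inj_on_of_nodup_map (by rw [h]; exact Finset.univ.nodup) v
      (Finset.mem_univ_val v) w (Finset.mem_univ_val w) hvw
  · exact univ_val_map_equiv (Equiv.ofBijective σ h) id |>.trans (Multiset.map_id _)

lemma hasExchange_squarefreeCoeff (d : ℕ) : HasExchange (squarefreeCoeff V) d := by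
  intro α β _ _ hα hβ a ha
  simp only [squarefreeCoeff, ne_eq, ite_eq_right_iff, one_ne_zero, imp_false, not_not] at hα hβ
  rw [hα, hβ] at ha
  exact absurd ha (lt_irrefl _)

lemma reverseCauchySchwarz_hessian_squarefreeCoeff {m : Multiset V}
    (hm : m.card < Fintype.card V) : ReverseCauchySchwarz (hessian (squarefreeCoeff V) m) := by
  obtain ⟨v, hv⟩ : ∃ v, v ∉ m := by
    by_contra! h
    refine hm.not_ge (Multiset.card_le_card (s := Finset.univ.val) ?_)
    exact (Multiset.le_iff_subset Finset.univ.nodup).2 fun v _ => h v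
  refine .of_star (hessian_isSymm _ _) v fun j k hj hk => if_neg fun h => ?_
  have : v ∈ j ::ₘ k ::ₘ m := h ▸ Finset.mem_univ_val v
  simp [hj.symm, hk.symm, hv] at this

/-- The permanent of the matrix whose columns are the vectors `a i` for `i` in `m`, counted with
multiplicity, when `m` has `|V|` elements. As a function of `m` it encodes the product of linear
forms `∏ v, ∑ i, a i v * x i`; see `permanentCoeff_map`. -/
def permanentCoeff (a : ι → V → ℝ) (m : Multiset ι) : ℝ :=
  contract (m.map a) (squarefreeCoeff V) 0

lemma permanentCoeff_nonneg {a : ι → V → ℝ} (ha : ∀ i v, 0 ≤ a i v) (m : Multiset ι) :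
    0 ≤ permanentCoeff a m := by
  refine contract_nonneg squarefreeCoeff_nonneg (fun x hx v => ?_) 0
  obtain ⟨i, _, rfl⟩ := Multiset.mem_map.1 hx
  exact ha i v

lemma permanentCoeff_map (a : ι → V → ℝ) (f : V → ι) :
    permanentCoeff a (Finset.univ.val.map f) = ∑ σ : Equiv.Perm V, ∏ t, a (f t) (σ t) := by
  rw [permanentCoeff, Multiset.map_map, contract_univ_map]
  simp only [add_zero, squarefreeCoeff_map]
  refine (Fintype.sum_of_injective (fun σ : Equiv.Perm V => (σ : V → V)) DFunLike.coe_injective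
    _ _ (fun g hg => ?_) fun σ => ?_).symm
  · rw [if_neg fun h => hg ⟨Equiv.ofBijective g h, rfl⟩, mul_zero]
  · rw [if_pos σ.bijective, mul_one]; rfl

/-- The Alexandrov-Fenchel inequality for permanents: the Hessian is the pullback, along the map
`p ↦ ∑ i, p i • a i`, of the Hessian of a directional derivative of `∏ v, z v`. -/
theorem reverseCauchySchwarz_hessian_permanentCoeff [Fintype ι] {a : ι → V → ℝ}
    (ha : ∀ i v, 0 ≤ a i v) {m : Multiset ι} (hm : m.card + 2 = Fintype.card V) :
    ReverseCauchySchwarz (hessian (permanentCoeff a) m) := by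
  have h1 : ReverseCauchySchwarz (hessian (contract (m.map a) (squarefreeCoeff V)) 0) := by
    refine reverseCauchySchwarz_hessian_contract (d := m.card) squarefreeCoeff_nonneg
      (hasExchange_squarefreeCoeff _)
      (fun m' hm' => reverseCauchySchwarz_hessian_squarefreeCoeff (by omega))
      (fun x hx v => ?_) (by simp)
    obtain ⟨i, _, rfl⟩ := Multiset.mem_map.1 hx
    exact ha i v
  have h2 : hessian (permanentCoeff a) m = (of fun v i => a i v)ᵀ *
      hessian (contract (m.map a) (squarefreeCoeff V)) 0 * (of fun v i => a i v) := by
    ext i j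
    have h3 := dotProduct_hessian_mulVec (contract (m.map a) (squarefreeCoeff V)) 0 (a i) (a j)
    rw [← contract_add] at h3
    rw [hessian_apply, permanentCoeff, Matrix.mul_assoc, mul_apply_eq_vecMul]
    simp only [Multiset.map_cons]
    rw [show a i ::ₘ a j ::ₘ m.map a = {a i, a j} + m.map a by
      simp [Multiset.insert_eq_cons], ← h3]
    rfl
  rw [h2]
  exact h1.congruence _

omit [DecidableEq V] in
lemma exists_univ_val_map_eq {m : Multiset ι} (hm : m.card = Fintype.card V) :
    ∃ f : V → ι, Finset.univ.val.map f = m := by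
  have e : V ≃ Fin m.toList.length := Fintype.equivFinOfCardEq (by simp [hm])
  refine ⟨m.toList.get ∘ e, ?_⟩
  rw [univ_val_map_equiv, Fin.univ_val_map, List.ofFn_get, Multiset.coe_toList]

lemma permanentCoeff_ne_zero_iff {a : ι → V → ℝ} (ha : ∀ i v, 0 ≤ a i v) {m : Multiset ι}
    (hm : m.card = Fintype.card V) :
    permanentCoeff a m ≠ 0 ↔ ∃ g : V → ι, (∀ v, a (g v) v ≠ 0) ∧ Finset.univ.val.map g = m := by
  have hsum (f : V → ι) : permanentCoeff a (Finset.univ.val.map f) ≠ 0 ↔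
      ∃ σ : Equiv.Perm V, ∀ t, a (f t) (σ t) ≠ 0 := by
    rw [permanentCoeff_map, Ne, Finset.sum_eq_zero_iff_of_nonneg fun σ _ =>
      Finset.prod_nonneg fun t _ => ha _ _]
    simp [Finset.prod_eq_zero_iff]
  constructor
  · obtain ⟨f, rfl⟩ := exists_univ_val_map_eq hm
    rw [hsum]
    rintro ⟨σ, hσ⟩
    refine ⟨f ∘ σ.symm, fun v => ?_, univ_val_map_equiv _ _⟩
    simpa using hσ (σ.symm v)
  · rintro ⟨g, hg, rfl⟩
    exact (hsum g).2 ⟨1, hg⟩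

/-- Exchange for fibre sizes of constrained maps `V → ι`, by an augmenting path: move a vertex `v`
from the fibre of `a = f v` to that of `g v`. If that fibre is not yet too large, stop; otherwise
continue from `g v`, with a map that agrees with `g` at one more vertex. -/
lemma exists_exchange_map [DecidableEq ι] {A : V → ι → Prop} {f g : V → ι} (hf : ∀ v, A v (f v))
    (hg : ∀ v, A v (g v)) {a : ι}
    (ha : (Finset.univ.val.map g).count a < (Finset.univ.val.map f).count a) :
    ∃ b, (Finset.univ.val.map f).count b < (Finset.univ.val.map g).count b ∧
      ∃ f' : V → ι, (∀ v, A v (f' v)) ∧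
        Finset.univ.val.map f' = b ::ₘ (Finset.univ.val.map f).erase a := by
  induction hN : (Finset.univ.filter fun v => f v ≠ g v).card using Nat.strong_induction_on
    generalizing f a with
  | _ N ih =>
    obtain ⟨v, hfv, hgv⟩ : ∃ v, f v = a ∧ g v ≠ a := by
      by_contra! h
      refine ha.not_ge ?_
      rw [Multiset.count_map, Multiset.count_map]
      refine Multiset.card_le_card (Multiset.monotone_filter_right _ fun v hv => ?_)
      exact (h v hv.symm).symm
    subst hfv
    have hsplit : (Finset.univ : Finset V).val = v ::ₘ (Finset.univ.erase v).val := by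
      rw [Finset.erase_val, Multiset.cons_erase (Finset.mem_univ_val v)]
    set f₁ := Function.update f v (g v) with hf₁
    set s := (Finset.univ.erase v).val.map f with hs
    have e1 : Finset.univ.val.map f = f v ::ₘ s := by rw [hsplit, Multiset.map_cons]
    have e2 : Finset.univ.val.map f₁ = g v ::ₘ s := by
      rw [hsplit, Multiset.map_cons, hf₁, Function.update_self]
      congr 1
      refine Multiset.map_congr rfl fun w hw => Function.update_of_ne ?_ _ _
      exact Finset.ne_of_mem_erase hw
    have hf₁A : ∀ w, A w (f₁ w) := by
      intro w
      by_cases hw : w = v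
      · subst hw; rw [hf₁, Function.update_self]; exact hg w
      · rw [hf₁, Function.update_of_ne hw]; exact hf w
    by_cases hc : (Finset.univ.val.map f).count (g v) < (Finset.univ.val.map g).count (g v)
    · exact ⟨g v, hc, f₁, hf₁A, by rw [e1, e2, Multiset.erase_cons_head]⟩
    rw [e1] at ha hc
    rw [Multiset.count_cons_of_ne hgv] at hc
    rw [Multiset.count_cons_self] at ha
    obtain ⟨b, hb, f', hf', e3⟩ := ih _ (by
        rw [← hN]
        refine Finset.card_lt_card (Finset.ssubset_iff_of_subset ?_ |>.2 ⟨v, ?_, ?_⟩)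
        · intro w
          simp only [Finset.mem_filter, Finset.mem_univ, true_and]
          intro hw h
          by_cases hwv : w = v
          · subst hwv; exact hw (by rw [hf₁, Function.update_self])
          · exact hw (by rw [hf₁, Function.update_of_ne hwv, h])
        · simp [Ne.symm hgv]
        · simp [hf₁]) (f := f₁) (a := g v) hf₁A
      (by rw [e2, Multiset.count_cons_self]; omega) rfl
    rw [e2] at hb e3
    rw [Multiset.erase_cons_head] at e3
    refine ⟨b, ?_, f', hf', by rw [e1, e3, Multiset.erase_cons_head]⟩
    rw [e1]
    by_cases hba : b = f v
    · subst hba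
      rw [Multiset.count_cons_of_ne (Ne.symm hgv)] at hb
      omega
    · rw [Multiset.count_cons_of_ne hba]
      exact (Multiset.count_le_count_cons _ _ _).trans_lt hb

lemma hasExchange_permanentCoeff [DecidableEq ι] {a : ι → V → ℝ} (ha : ∀ i v, 0 ≤ a i v) :
    HasExchange (permanentCoeff a) (Fintype.card V) := by
  intro α β hα hβ hcα hcβ i hi
  obtain ⟨f, hf, rfl⟩ := (permanentCoeff_ne_zero_iff ha hα).1 hcα
  obtain ⟨g, hg, rfl⟩ := (permanentCoeff_ne_zero_iff ha hβ).1 hcβ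
  obtain ⟨b, hb, f', hf', e⟩ := exists_exchange_map (A := fun v i => a i v ≠ 0) hf hg hi
  refine ⟨b, hb, (permanentCoeff_ne_zero_iff ha ?_).2 ⟨f', hf', e⟩⟩
  rw [← e, Multiset.card_map]; rfl

end Permanent

/-! ### Counting valid maps -/

section GMaps

variable {V K : Type*}

/-- The constraint for encoding a `G`-map as a total map `V → Option K`: the value `none`, standing
for being outside the domain, is allowed everywhere, and `some j` only at the neighbours of `j`. -/
def OptionAdj (G : SimpleGraph (V ⊕ K)) (i : Option K) (v : V) : Prop :=
  ∀ j, i = some j → G.Adj (Sum.inl v) (Sum.inr j)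

open Classical in
/-- The total map `V → Option K` encoding a `G`-map; it is `none` outside the domain. -/
noncomputable def GMap.toOption {G : SimpleGraph (V ⊕ K)} (f : GMap G) (v : V) : Option K :=
  if h : v ∈ f.dom then some (f.toFun ⟨v, h⟩) else none

variable {G : SimpleGraph (V ⊕ K)}

lemma GMap.toOption_ne_none_iff (f : GMap G) (v : V) : f.toOption v ≠ none ↔ v ∈ f.dom := by
  rw [toOption]; split_ifs with h <;> simp [h]

lemma GMap.toOption_eq_some_iff (f : GMap G) (v : V) (j : K) :
    f.toOption v = some j ↔ ∃ h : v ∈ f.dom, f.toFun ⟨v, h⟩ = j := by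
  rw [toOption]; split_ifs with h <;> simp [h]

lemma GMap.optionAdj_toOption (f : GMap G) (v : V) : OptionAdj G (f.toOption v) v := by
  intro j hj
  obtain ⟨h, rfl⟩ := (f.toOption_eq_some_iff v j).1 hj
  exact f.adj ⟨v, h⟩

lemma GMap.toOption_injective : Function.Injective (GMap.toOption (G := G)) := by
  intro f g hfg
  have hdom : f.dom = g.dom := by
    ext v; rw [← f.toOption_ne_none_iff, hfg, g.toOption_ne_none_iff]
  obtain ⟨A, f, hf⟩ := f
  obtain ⟨B, g, hg⟩ := g
  obtain rfl : A = B := hdom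
  congr 1
  funext v
  have h := (GMap.toOption_eq_some_iff ⟨A, f, hf⟩ v (f v)).2 ⟨v.2, rfl⟩
  rw [hfg, GMap.toOption_eq_some_iff] at h
  exact h.2.symm

lemma GMap.exists_toOption_eq [Fintype V] {g : V → Option K} (hg : ∀ v, OptionAdj G (g v) v) :
    ∃ f : GMap G, f.toOption = g := by
  classical
  have hsome (v : {v // v ∈ Finset.univ.filter fun v => g v ≠ none}) : (g v).isSome := by
    have := v.2
    rw [Finset.mem_filter] at this
    exact Option.isSome_iff_ne_none.2 this.2
  refine ⟨⟨Finset.univ.filter fun v => g v ≠ none, fun v => (g v).get (hsome v),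
    fun v => hg v _ (Option.some_get _).symm⟩, ?_⟩
  funext v
  rw [toOption]
  split_ifs with h
  · exact Option.some_get _
  · by_contra hne
    exact h (Finset.mem_filter.2 ⟨Finset.mem_univ v, Ne.symm hne⟩)

lemma GMap.ncard_fiber [Fintype V] [DecidableEq (Option K)] (f : GMap G) (j : K) :
    (f.toFun ⁻¹' {j}).ncard = (Finset.univ.val.map f.toOption).count (some j) := by
  classical
  rw [Multiset.count_map, ← Finset.filter_val, Finset.card_val,
    ← Set.ncard_image_of_injective _ Subtype.val_injective, ← Set.ncard_coe_finset]
  congr 1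
  ext v
  simp only [Set.mem_image, Set.mem_preimage, Set.mem_singleton_iff, Subtype.exists,
    exists_and_right, exists_eq_right, Finset.coe_filter, Finset.mem_univ, true_and,
    Set.mem_ofPred_eq]
  rw [eq_comm (a := some j), f.toOption_eq_some_iff]

/-- The lower bounds `l`, extended by the vacuous bound `0` at `none`. -/
def optionLower (l : K → ℕ) (i : Option K) : ℕ := i.elim 0 l

/-- The upper bounds `u`, extended by `n` at `none`; this is vacuous for fibres of maps from a set
with `n` elements. -/
def optionUpper (n : ℕ) (u : K → ℕ) (i : Option K) : ℕ := i.elim n u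

lemma GMap.isValid_iff [Fintype V] [DecidableEq (Option K)] (f : GMap G) (l u : K → ℕ) :
    f.IsValid l u ↔ InBounds (optionLower l) (optionUpper (Fintype.card V) u)
      (Finset.univ.val.map f.toOption) := by
  simp only [IsValid, InBounds, Option.forall, f.ncard_fiber, optionLower, optionUpper,
    Option.elim_none, Option.elim_some, zero_le, true_and]
  refine (and_iff_right ?_).symm
  exact (Multiset.count_le_card _ _).trans (by simp)

lemma GMap.card_dom [Fintype V] [DecidableEq (Option K)] (f : GMap G) :
    f.dom.card = (Finset.univ.filter fun v => f.toOption v ≠ none).card := by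
  congr 1; ext v; simp [f.toOption_ne_none_iff]

variable [Fintype V] [DecidableEq (Option K)]

lemma numValid_eq_card (G : SimpleGraph (V ⊕ K)) (l u : K → ℕ) (k : ℕ) :
    numValid G l u k = Nat.card {g : V → Option K // (∀ v, OptionAdj G (g v) v) ∧
      InBounds (optionLower l) (optionUpper (Fintype.card V) u) (Finset.univ.val.map g) ∧
      (Finset.univ.filter fun v => g v ≠ none).card = k} := by
  refine Nat.card_eq_of_bijective
    (fun f => ⟨f.1.toOption, f.1.optionAdj_toOption, (f.1.isValid_iff l u).1 f.2.1,
      by rw [← f.1.card_dom, f.2.2]⟩) ⟨fun f g h => ?_, ?_⟩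
  · exact Subtype.ext (GMap.toOption_injective (congrArg Subtype.val h))
  · rintro ⟨g, hg, h1, h2⟩
    obtain ⟨f, rfl⟩ := GMap.exists_toOption_eq hg
    exact ⟨⟨f, (f.isValid_iff l u).2 h1, by rw [f.card_dom, h2]⟩, rfl⟩

open Classical in
/-- The `0`-`1` matrix of the relation `OptionAdj G`. -/
noncomputable def adjWeight (G : SimpleGraph (V ⊕ K)) (i : Option K) (v : V) : ℝ :=
  if OptionAdj G i v then 1 else 0

omit [Fintype V] [DecidableEq (Option K)] in
lemma adjWeight_nonneg (i : Option K) (v : V) : 0 ≤ adjWeight G i v := by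
  rw [adjWeight]; split_ifs <;> norm_num

omit [Fintype V] [DecidableEq (Option K)] in
lemma adjWeight_ne_zero_iff (i : Option K) (v : V) : adjWeight G i v ≠ 0 ↔ OptionAdj G i v := by
  rw [adjWeight]; split_ifs with h <;> simp [h]

variable [DecidableEq V]

/-- The coefficients of the generating form of valid `G`-maps: the product over `v` of the sums of
the variables `x i` with `OptionAdj G i v`, truncated to the exponents within the bounds. -/
noncomputable def gmapCoeff (G : SimpleGraph (V ⊕ K)) (l u : K → ℕ) : Multiset (Option K) → ℝ :=
  truncate (optionLower l) (optionUpper (Fintype.card V) u) (permanentCoeff (adjWeight G))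

lemma gmapCoeff_nonneg (l u : K → ℕ) (m : Multiset (Option K)) : 0 ≤ gmapCoeff G l u m :=
  truncate_nonneg (permanentCoeff_nonneg adjWeight_nonneg) m

/-- The indicator vector of `K` in `Option K`. -/
def someIndicator (K : Type*) (i : Option K) : ℝ := i.elim 0 fun _ => 1

/-- The indicator vector of `none` in `Option K`. -/
def noneIndicator (K : Type*) (i : Option K) : ℝ := i.elim 1 fun _ => 0

lemma univ_val_map_ite (S : Finset V) {α : Type*} (x y : α) :
    Finset.univ.val.map (fun v => if v ∈ S then x else y) =
      Multiset.replicate S.card x + Multiset.replicate (Fintype.card V - S.card) y := by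
  have h : (Finset.univ : Finset V).val = S.val + Sᶜ.val := by
    rw [← Finset.disjUnion_val (h := disjoint_compl_right), Finset.disjUnion_eq_union,
      Finset.union_compl]
  rw [h, Multiset.map_add, Multiset.map_congr rfl (g := fun _ => x),
    Multiset.map_congr (s := Sᶜ.val) rfl (g := fun _ => y), Multiset.map_const',
    Multiset.map_const', Finset.card_val, Finset.card_val, Finset.card_compl]
  · exact fun v hv => if_neg (Finset.mem_compl.1 hv)
  · exact fun v hv => if_pos hv

lemma prod_some_none_indicator (S : Finset V) (f : V → Option K) :
    ∏ t, (if t ∈ S then someIndicator K else noneIndicator K) (f t) =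
      if S = Finset.univ.filter (fun t => f t ≠ none) then 1 else 0 := by
  have h (t) : (if t ∈ S then someIndicator K else noneIndicator K) (f t) =
      if (t ∈ S ↔ f t ≠ none) then 1 else 0 := by
    by_cases ht : t ∈ S <;> rcases hf : f t with _ | j <;>
      simp [ht, someIndicator, noneIndicator]
  simp only [h, Finset.ext_iff, Finset.mem_filter, Finset.mem_univ, true_and]
  rw [Finset.prod_ite_zero]
  simp

/-- The mixed derivative of the generating form of valid `G`-maps, `a` times along the indicator of
`K` and `b` times along that of `none`. -/
noncomputable def mixedCount [Fintype K] (G : SimpleGraph (V ⊕ K)) (l u : K → ℕ) (a b : ℕ) : ℝ :=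
  contract (Multiset.replicate a (someIndicator K) + Multiset.replicate b (noneIndicator K))
    (gmapCoeff G l u) 0

/-- Double counting. Expanding the mixed derivative with the slots indexed by `V`, where the slots in
a given `k`-set `S` carry `someIndicator` and the others `noneIndicator`, it counts pairs of a valid
map `g` and a permutation `σ` with `S = σ⁻¹ (dom g)`. Summed over all `S`, each `g` with a domain of
size `k` is counted once for each `σ`. -/
theorem choose_mul_mixedCount [Fintype K] (G : SimpleGraph (V ⊕ K)) (l u : K → ℕ) (k : ℕ) :
    ((Fintype.card V).choose k : ℝ) * mixedCount G l u k (Fintype.card V - k) =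
      (Fintype.card V).factorial * numValid G l u k := by
  classical
  set P : (V → Option K) → Prop := fun g => (∀ v, OptionAdj G (g v) v) ∧
      InBounds (optionLower l) (optionUpper (Fintype.card V) u) (Finset.univ.val.map g) with hP
  have hg (f : V → Option K) : gmapCoeff G l u (Finset.univ.val.map f) =
      ∑ σ : Equiv.Perm V, if P (f ∘ σ.symm) then 1 else 0 := by
    rw [gmapCoeff, truncate, permanentCoeff_map]
    have e (σ : Equiv.Perm V) : ∏ t, adjWeight G (f t) (σ t) =
        if ∀ v, OptionAdj G ((f ∘ σ.symm) v) v then 1 else 0 := by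
      rw [← σ.symm.prod_comp]
      simp only [adjWeight, Function.comp_apply, Equiv.apply_symm_apply]
      rw [Finset.prod_ite_zero]
      simp
    simp only [hP, e, univ_val_map_equiv, ite_and]
    split_ifs <;> simp
  have hS (S : Finset V) (hS : S ∈ Finset.univ.powersetCard k) :
      mixedCount G l u k (Fintype.card V - k) = ∑ σ : Equiv.Perm V, ∑ g : V → Option K,
        if P g ∧ S = Finset.univ.filter (fun t => g (σ t) ≠ none) then 1 else 0 := by
    obtain rfl := (Finset.mem_powersetCard.1 hS).2
    rw [mixedCount, ← univ_val_map_ite, contract_univ_map]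
    simp only [add_zero, prod_some_none_indicator, hg, Finset.mul_sum]
    rw [Finset.sum_comm]
    refine Finset.sum_congr rfl fun σ _ => ?_
    rw [← (σ.symm.arrowCongr (Equiv.refl (Option K))).sum_comp]
    refine Finset.sum_congr rfl fun g _ => ?_
    have e1 : (σ.symm.arrowCongr (Equiv.refl (Option K)) g) ∘ σ.symm = g := by
      funext v; simp
    simp only [e1, and_comm (a := P g), ite_and, ite_mul, one_mul, zero_mul]
    rfl
  calc ((Fintype.card V).choose k : ℝ) * mixedCount G l u k (Fintype.card V - k)
      = ∑ S ∈ (Finset.univ : Finset V).powersetCard k,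
          mixedCount G l u k (Fintype.card V - k) := by
        rw [Finset.sum_const, Finset.card_powersetCard, nsmul_eq_mul, Finset.card_univ]
    _ = ∑ σ : Equiv.Perm V, ∑ g : V → Option K,
          if P g ∧ (Finset.univ.filter fun v => g v ≠ none).card = k then 1 else 0 := by
        rw [Finset.sum_congr rfl hS, Finset.sum_comm]
        refine Finset.sum_congr rfl fun σ _ => ?_
        rw [Finset.sum_comm]
        refine Finset.sum_congr rfl fun g _ => ?_
        have hcard : (Finset.univ.filter fun t => g (σ t) ≠ none).card =
            (Finset.univ.filter fun v => g v ≠ none).card :=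
          Finset.card_bij (fun t _ => σ t) (by simp) (fun _ _ _ _ h => σ.injective h)
            fun v hv => ⟨σ.symm v, by simpa using hv, by simp⟩
        simp only [ite_and]
        split_ifs with h1 h2
        · rw [Finset.sum_ite_eq', if_pos]
          exact Finset.mem_powersetCard.2 ⟨Finset.subset_univ _, hcard.trans h2⟩
        · rw [Finset.sum_ite_eq', if_neg]
          exact fun h => h2 (hcard.symm.trans (Finset.mem_powersetCard.1 h).2)
        · simp
    _ = (Fintype.card V).factorial * numValid G l u k := by
        rw [Finset.sum_const, Finset.card_univ, Fintype.card_perm, nsmul_eq_mul, Finset.sum_boole,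
          numValid_eq_card, Nat.card_eq_fintype_card, Fintype.card_subtype]
        simp only [hP, and_assoc]

theorem mixedCount_mul_le [Fintype K] (G : SimpleGraph (V ⊕ K)) (l u : K → ℕ) {i : ℕ}
    (hi : i + 2 ≤ Fintype.card V) :
    mixedCount G l u i (Fintype.card V - i) * mixedCount G l u (i + 2) (Fintype.card V - (i + 2)) ≤
      mixedCount G l u (i + 1) (Fintype.card V - (i + 1)) ^ 2 := by
  obtain ⟨d, hd⟩ := Nat.exists_eq_add_of_le hi
  set s := Multiset.replicate i (someIndicator K) + Multiset.replicate d (noneIndicator K) with hs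
  have hs0 : ∀ x ∈ s, ∀ i, 0 ≤ x i := by
    intro x hx i
    rcases Multiset.mem_add.1 hx with hx | hx <;> rw [Multiset.eq_of_mem_replicate hx] <;>
      cases i <;> simp [someIndicator, noneIndicator]
  have hR : ReverseCauchySchwarz (hessian (contract s (gmapCoeff G l u)) 0) := by
    refine reverseCauchySchwarz_hessian_contract (d := i + d) (gmapCoeff_nonneg l u) ?_
      (fun m hm => reverseCauchySchwarz_hessian_truncate (permanentCoeff_nonneg adjWeight_nonneg)
        (reverseCauchySchwarz_hessian_permanentCoeff adjWeight_nonneg (by omega))) hs0 (by simp [hs])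
    rw [show i + d + 2 = Fintype.card V by omega]
    exact (hasExchange_permanentCoeff adjWeight_nonneg).truncate
  have hcomb (t : Multiset (Option K → ℝ)) (a b : ℕ) (hab : t + s =
      Multiset.replicate a (someIndicator K) + Multiset.replicate b (noneIndicator K)) :
      contract t (contract s (gmapCoeff G l u)) 0 = mixedCount G l u a b := by
    rw [← contract_add, hab, mixedCount]
  have h1 := hcomb {someIndicator K, someIndicator K} (i + 2) d (by
    rw [hs, Multiset.replicate_succ, Multiset.replicate_succ, Multiset.insert_eq_cons]
    simp only [← Multiset.singleton_add]; abel)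
  have h2 := hcomb {noneIndicator K, noneIndicator K} i (d + 2) (by
    rw [hs, Multiset.replicate_succ, Multiset.replicate_succ, Multiset.insert_eq_cons]
    simp only [← Multiset.singleton_add]; abel)
  have h3 := hcomb {someIndicator K, noneIndicator K} (i + 1) (d + 1) (by
    rw [hs, Multiset.replicate_succ, Multiset.replicate_succ, Multiset.insert_eq_cons]
    simp only [← Multiset.singleton_add]; abel)
  have key := hR (someIndicator K) (noneIndicator K)
  rw [dotProduct_hessian_mulVec, dotProduct_hessian_mulVec, dotProduct_hessian_mulVec, h1, h2, h3]
    at key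
  rw [show Fintype.card V - i = d + 2 by omega, show Fintype.card V - (i + 2) = d by omega,
    show Fintype.card V - (i + 1) = d + 1 by omega]
  have h0 : 0 ≤ mixedCount G l u (i + 2) d := by
    rw [← h1]
    refine contract_nonneg (contract_nonneg (gmapCoeff_nonneg l u) hs0) (fun x hx j => ?_) 0
    have : x = someIndicator K := by simpa using hx
    subst this
    cases j <;> simp [someIndicator]
  rcases h0.eq_or_lt with h0 | h0
  · rw [← h0, mul_zero]; positivity
  · rw [mul_comm]; exact key h0

omit [DecidableEq V] in
lemma numValid_ne_zero_iff [Fintype K] (l u : K → ℕ) (k : ℕ) :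
    numValid G l u k ≠ 0 ↔ ∃ g : V → Option K, (∀ v, OptionAdj G (g v) v) ∧
      InBounds (optionLower l) (optionUpper (Fintype.card V) u) (Finset.univ.val.map g) ∧
      (Finset.univ.val.map g).count none + k = Fintype.card V := by
  rw [numValid_eq_card, Nat.card_ne_zero, and_iff_left (Subtype.finite), nonempty_subtype]
  refine exists_congr fun g => and_congr_right fun _ => and_congr_right fun _ => ?_
  have h := Finset.card_filter_add_card_filter_not (s := Finset.univ) (fun v => g v = none)
  have hcount : (Finset.univ.val.map g).count none =
      (Finset.univ.filter fun v => g v = none).card := by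
    rw [Multiset.count_map, ← Finset.filter_val, Finset.card_val]
    congr 1
    ext v
    simp [eq_comm]
  rw [Finset.card_univ] at h
  rw [hcount]
  simp only [ne_eq]
  omega

/-- One exchange at `none` enlarges the domain of a valid map by one vertex. -/
lemma numValid_succ_ne_zero [Fintype K] {l u : K → ℕ} {i k : ℕ} (hik : i < k)
    (hi : numValid G l u i ≠ 0) (hk : numValid G l u k ≠ 0) : numValid G l u (i + 1) ≠ 0 := by
  obtain ⟨f, hf, hfb, hfc⟩ := (numValid_ne_zero_iff l u i).1 hi
  obtain ⟨g, hg, hgb, hgc⟩ := (numValid_ne_zero_iff l u k).1 hk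
  have hex := (hasExchange_permanentCoeff (adjWeight_nonneg (G := G))).truncate
    (l := optionLower l) (u := optionUpper (Fintype.card V) u)
  have hcard (g : V → Option K) : (Finset.univ.val.map g).card = Fintype.card V := by
    rw [Multiset.card_map]; rfl
  have hne {g : V → Option K} (hg : ∀ v, OptionAdj G (g v) v) :
      permanentCoeff (adjWeight G) (Finset.univ.val.map g) ≠ 0 :=
    (permanentCoeff_ne_zero_iff adjWeight_nonneg (hcard g)).2
      ⟨g, fun v => (adjWeight_ne_zero_iff _ _).2 (hg v), rfl⟩
  obtain ⟨b, hb, hcb⟩ := hex _ _ (hcard f) (hcard g) (truncate_ne_zero_iff.2 ⟨hfb, hne hf⟩)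
    (truncate_ne_zero_iff.2 ⟨hgb, hne hg⟩) none (by omega)
  have hmem : none ∈ Finset.univ.val.map f := Multiset.count_pos.1 (by omega)
  have hbn : b ≠ none := by rintro rfl; omega
  rw [truncate_ne_zero_iff, permanentCoeff_ne_zero_iff adjWeight_nonneg
    (by rw [Multiset.card_cons, Multiset.card_erase_add_one hmem, hcard])] at hcb
  obtain ⟨hbd, f', hf', e⟩ := hcb
  refine (numValid_ne_zero_iff l u (i + 1)).2
    ⟨f', fun v => (adjWeight_ne_zero_iff _ _).1 (hf' v), e ▸ hbd, ?_⟩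
  rw [e, Multiset.count_cons_of_ne hbn.symm, Multiset.count_erase_self]
  have := Multiset.count_pos.2 hmem
  omega

end GMaps

theorem theorem4p5 {V K : Type*} [Fintype V] [Fintype K]
    (G : SimpleGraph (V ⊕ K)) (hG : G ≤ completeBipartiteGraph V K)
    (l u : K → ℕ) (hlu : ∀ j, l j ≤ u j) :
    IsUltraLogConcave (Fintype.card V) (fun k => (numValid G l u k : ℝ)) := by
  classical
  constructor
  · intro i j k hij hjk _ hi hk
    simp only [ne_eq, Nat.cast_eq_zero] at hi hk ⊢
    induction j, hij.le using Nat.le_induction with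
    | base => exact hi
    | succ j hle ih =>
      refine numValid_succ_ne_zero (by omega : j < k) ?_ hk
      rcases hle.eq_or_lt with rfl | h
      · exact hi
      · exact ih h (by omega)
  · intro i hi
    have hfac : (0 : ℝ) < (Fintype.card V).factorial := by positivity
    have hdiv (k : ℕ) (hk : k ≤ Fintype.card V) :
        (numValid G l u k : ℝ) / ((Fintype.card V).choose k : ℝ) =
          mixedCount G l u k (Fintype.card V - k) / (Fintype.card V).factorial := by
      have h0 : ((Fintype.card V).choose k : ℝ) ≠ 0 :=
        Nat.cast_ne_zero.2 (Nat.choose_pos hk).ne'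
      rw [div_eq_div_iff h0 hfac.ne', mul_comm, ← choose_mul_mixedCount, mul_comm]
    simp only [hdiv i (by omega), hdiv (i + 1) (by omega), hdiv (i + 2) hi]
    rw [div_mul_div_comm, div_pow, ← sq]
    exact div_le_div_of_nonneg_right (mixedCount_mul_le G l u hi) (by positivity)
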